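/- Let $d\ge 1$ be an integer and let $\nu,\alpha,\beta,\sigma^2>0$. The Confluent Hypergeometric (CH) covariance function on $\mathbb{R}^d$ is $x\mapsto C(|x|)$, where $$C(h)=\frac{\sigma^2\beta^{2\alpha}\Gamma(\nu+\alpha)}{\Gamma(\nu)\Gamma(\alpha)}\int_0^\infty x^{\nu-1}(x+\beta^2)^{-(\nu+\alpha)}\exp(-\nu h^2/x)\,dx .$$ A spectral density of it is a continuous function $f:[0,\infty)\to[0,\infty]$ with $\int_{\mathbb{R}^d} f(|\omega|)\,d\omega<\infty$ and $C(|x|)=\int_{\mathbb{R}^d}e^{i x^\top\omega}f(|\omega|)\,d\omega$ for all $x\in\mathbb{R}^d$. Then $C$ has exactly one spectral density $f$, and $$f(\omega)\sim\frac{\sigma^2\,2^{2\nu}\nu^\nu\,\Gamma(\nu+\alpha)}{\pi^{d/2}\beta^{2\nu}\,\Gamma(\alpha)}\cdot\frac{\Gamma(\nu+d/2)}{\Gamma(\nu)}\;\omega^{-(2\nu+d)}L(\omega^2),\qquad \omega\to\infty,$$ where $L(x)=\{x/(x+\beta^2/(2\nu))\}^{\nu+d/2}$ is slowly varying at $\infty$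 (that is, $L(tx)/L(x)\to 1$ as $x\to\infty$ for every $t>0$), and $\sim$ means that the ratio tends to $1$. If moreover $\alpha>d/2$, then $f(\omega)<\infty$ for every $\omega\ge 0$, the function $x\mapsto C(|x|)$ is integrable on $\mathbb{R}^d$, and $f(|\omega|)=(2\pi)^{-d}\int_{\mathbb{R}^d}e^{-i\omega^\top x}C(|x|)\,dx$ for all $\omega\in\mathbb{R}^d$. -/

import Mathlib

open MeasureTheory Filter Topology Asymptotics
open scoped NNReal ENNReal

noncomputable section

/-- The confluent hypergeometric (CH) covariance function `C(h; ν, α, β, σ²)`. -/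
def chCov (ν α β σ h : ℝ) : ℝ :=
  σ ^ 2 * β ^ (2 * α) * Real.Gamma (ν + α) / (Real.Gamma ν * Real.Gamma α) *
    ∫ x in Set.Ioi (0 : ℝ),
      x ^ (ν - 1) * (x + β ^ 2) ^ (-(ν + α)) * Real.exp (-(ν * h ^ 2 / x))

/-- `f : [0, ∞) → [0, ∞]` is the (continuous) spectral density of the isotropic covariance function
`x ↦ C ‖x‖` on `ℝ^d`: the measure `f(‖ω‖) dω` is finite, and its Fourier transform is the covariance,
`C(‖x‖) = ∫ exp(i ⟨x, ω⟩) f(‖ω‖) dω` for every `x`. Continuity fixes the version of the density;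
the value `∞` is allowed because the density may have a pole at frequency zero. -/
def IsSpectralDensity (d : ℕ) (C : ℝ → ℝ) (f : ℝ≥0 → ℝ≥0∞) : Prop :=
  Continuous f ∧
  (∫⁻ ω : EuclideanSpace ℝ (Fin d), f ‖ω‖₊) < ∞ ∧
  ∀ x : EuclideanSpace ℝ (Fin d),
    (C ‖x‖ : ℂ) = ∫ ω : EuclideanSpace ℝ (Fin d),
      Complex.exp (Complex.I * (inner ℝ x ω : ℝ)) * ((f ‖ω‖₊).toReal : ℂ)

/-- Slow variation at infinity. -/
def SlowlyVarying (L : ℝ → ℝ) : Prop :=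
  ∀ t : ℝ, 0 < t → Tendsto (fun x => L (t * x) / L x) atTop (𝓝 1)

/-- The function `L(x) = {x / (x + β²/(2ν))}^{ν + d/2}`. -/
def tailL (d : ℕ) (ν β x : ℝ) : ℝ :=
  (x / (x + β ^ 2 / (2 * ν))) ^ (ν + (d : ℝ) / 2)

end

/-! The covariance is a scale mixture over `u > 0` of the Gaussians `exp (-ν h² / u)`. Each is the
Fourier transform of a normal density proportional to `exp (-u r² / (4ν))`, so Fubini
(`integral_cexp_mul_gaussianMixture`) exhibits the mixture of these normal densities as a spectral
density. It is the only one: characteristic functions determine finite measures, and continuous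
densities that agree a.e. agree everywhere.

In `λ = r² / (4ν)` this density is, up to a constant, the Laplace transform of `u^(ν + d/2 - 1) (u +
β²)^(-(ν + α))`, so its tail comes from the behaviour of the weight at `u = 0` (Watson's lemma,
`tendsto_rpow_mul_laplace_rpow_mul_add_rpow`). Since `tailL` tends to 1, inserting it does not
affect the equivalence.

When `α > d/2` the spectral weight is itself integrable. This bounds the density at frequency zero
and lets the same Fubini argument run in the other direction, giving inversion. -/

section GaussianMixture

variable {V : Type*} [NormedAddCommGroup V] [InnerProductSpace ℝ V] [FiniteDimensional ℝ V]
  [MeasurableSpace V] [BorelSpace V]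

/-- By Tonelli: the Gaussian integral over `V` is `(π / b u)^(n/2)`, so `hint` is exactly
integrability of the inner integrals of the norm. -/
theorem integrable_gaussianMixture_prod {w b : ℝ → ℝ} (hw : Measurable w) (hb : Measurable b)
    (hw0 : ∀ u, 0 < u → 0 ≤ w u) (hb0 : ∀ u, 0 < u → 0 < b u)
    (hint : IntegrableOn (fun u => w u * (Real.pi / b u) ^ ((Module.finrank ℝ V : ℝ) / 2))
      (Set.Ioi 0)) :
    Integrable (fun p : ℝ × V => w p.1 * Real.exp (-(b p.1 * ‖p.2‖ ^ 2)))
      ((volume.restrict (Set.Ioi 0)).prod volume) := by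
  have hmeas : Measurable (fun p : ℝ × V => w p.1 * Real.exp (-(b p.1 * ‖p.2‖ ^ 2))) := by
    fun_prop
  rw [integrable_prod_iff hmeas.aestronglyMeasurable]
  constructor
  · filter_upwards [self_mem_ae_restrict measurableSet_Ioi] with u hu
    have h := GaussianFourier.integrable_cexp_neg_mul_sq_norm_add (V := V) (b := (b u : ℂ))
      (by simpa using hb0 u hu) 0 0
    refine (h.norm.congr (ae_of_all _ fun v => ?_)).const_mul (w u)
    simp [Complex.norm_exp, ← Complex.ofReal_pow]
  · refine hint.congr ?_
    filter_upwards [self_mem_ae_restrict measurableSet_Ioi] with u hu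
    have hwu : ∀ v : V, ‖w u * Real.exp (-(b u * ‖v‖ ^ 2))‖ = w u * Real.exp (-b u * ‖v‖ ^ 2) := by
      intro v
      rw [Real.norm_of_nonneg (mul_nonneg (hw0 u hu) (Real.exp_nonneg _)), neg_mul]
    simp_rw [hwu]
    rw [integral_const_mul, GaussianFourier.integral_rexp_neg_mul_sq_norm (hb0 u hu)]

theorem integrable_gaussianMixture {w b : ℝ → ℝ} (hw : Measurable w) (hb : Measurable b)
    (hw0 : ∀ u, 0 < u → 0 ≤ w u) (hb0 : ∀ u, 0 < u → 0 < b u)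
    (hint : IntegrableOn (fun u => w u * (Real.pi / b u) ^ ((Module.finrank ℝ V : ℝ) / 2))
      (Set.Ioi 0)) :
    Integrable (fun x : V => ∫ u in Set.Ioi (0 : ℝ), w u * Real.exp (-(b u * ‖x‖ ^ 2))) :=
  (integrable_gaussianMixture_prod hw hb hw0 hb0 hint).integral_prod_right

theorem lintegral_gaussianMixture_lt_top {w b : ℝ → ℝ} (hw : Measurable w) (hb : Measurable b)
    (hw0 : ∀ u, 0 < u → 0 ≤ w u) (hb0 : ∀ u, 0 < u → 0 < b u)
    (hint : IntegrableOn (fun u => w u * (Real.pi / b u) ^ ((Module.finrank ℝ V : ℝ) / 2))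
      (Set.Ioi 0)) :
    ∫⁻ x : V, ∫⁻ u in Set.Ioi (0 : ℝ), ENNReal.ofReal (w u * Real.exp (-(b u * ‖x‖ ^ 2))) < ∞ := by
  have h := (integrable_gaussianMixture_prod (V := V) hw hb hw0 hb0 hint).lintegral_lt_top
  rwa [lintegral_prod_symm _ (by fun_prop)] at h

/-- Used twice: with `b u = u / (4ν)` from density to covariance, and with `b u = ν / u` for the
inversion formula. -/
theorem integral_cexp_mul_gaussianMixture {w b : ℝ → ℝ} (hw : Measurable w) (hb : Measurable b)
    (hw0 : ∀ u, 0 < u → 0 ≤ w u) (hb0 : ∀ u, 0 < u → 0 < b u)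
    (hint : IntegrableOn (fun u => w u * (Real.pi / b u) ^ ((Module.finrank ℝ V : ℝ) / 2))
      (Set.Ioi 0)) (y : V) :
    ∫ x : V, Complex.exp (Complex.I * (inner ℝ y x : ℝ)) *
        ((∫ u in Set.Ioi (0 : ℝ), w u * Real.exp (-(b u * ‖x‖ ^ 2)) : ℝ) : ℂ) =
      ((∫ u in Set.Ioi (0 : ℝ), w u * (Real.pi / b u) ^ ((Module.finrank ℝ V : ℝ) / 2) *
        Real.exp (-(1 / (4 * b u) * ‖y‖ ^ 2)) : ℝ) : ℂ) := by
  have hprod : Integrable (Function.uncurry fun (u : ℝ) (x : V) =>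
      Complex.exp (Complex.I * (inner ℝ y x : ℝ)) *
        ((w u * Real.exp (-(b u * ‖x‖ ^ 2)) : ℝ) : ℂ))
      ((volume.restrict (Set.Ioi 0)).prod volume) := by
    refine (integrable_gaussianMixture_prod (V := V) hw hb hw0 hb0 hint).ofReal.bdd_mul (c := 1)
      (f := fun p : ℝ × V => Complex.exp (Complex.I * (inner ℝ y p.2 : ℝ))) ?_ ?_
    · exact Measurable.aestronglyMeasurable (by fun_prop)
    · refine ae_of_all _ fun p => ?_
      rw [mul_comm, Complex.norm_exp_ofReal_mul_I]
  have hswap := integral_integral_swap hprod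
  calc _ = ∫ x : V, ∫ u in Set.Ioi (0 : ℝ), Complex.exp (Complex.I * (inner ℝ y x : ℝ)) *
        ((w u * Real.exp (-(b u * ‖x‖ ^ 2)) : ℝ) : ℂ) := by
        congr with x
        rw [integral_const_mul, integral_complex_ofReal]
    _ = _ := by
        rw [← hswap, ← integral_complex_ofReal]
        refine setIntegral_congr_fun measurableSet_Ioi fun u hu => ?_
        have hu' := hb0 u hu
        have hg := GaussianFourier.integral_cexp_neg_mul_sq_norm_add (V := V) (b := (b u : ℂ))
          (by simpa using hu') Complex.I y
        have heq : ∀ x : V, Complex.exp (Complex.I * (inner ℝ y x : ℝ)) *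
            ((w u * Real.exp (-(b u * ‖x‖ ^ 2)) : ℝ) : ℂ) =
            w u * Complex.exp (-(b u : ℂ) * (‖x‖ : ℂ) ^ 2 + Complex.I * (inner ℝ y x : ℝ)) := by
          intro x
          rw [Complex.exp_add]
          push_cast
          ring_nf
        simp_rw [heq]
        rw [integral_const_mul, hg]
        have hpow : ((Real.pi : ℂ) / b u) ^ ((Module.finrank ℝ V : ℂ) / 2) =
            (((Real.pi / b u) ^ ((Module.finrank ℝ V : ℝ) / 2) : ℝ) : ℂ) := by
          rw [Complex.ofReal_cpow (by positivity)]
          push_cast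
          rfl
        rw [hpow, Complex.I_sq]
        push_cast
        rw [mul_assoc]
        congr 3
        ring

end GaussianMixture

/-! ### Gaussian mixtures as functions of the radius -/

theorem toReal_lintegral_ofReal_mul_exp {w b : ℝ → ℝ} (hw : Measurable w) (hb : Measurable b)
    (hw0 : ∀ u, 0 < u → 0 ≤ w u) (r : ℝ) :
    (∫⁻ u in Set.Ioi (0 : ℝ), ENNReal.ofReal (w u * Real.exp (-(b u * r ^ 2)))).toReal =
      ∫ u in Set.Ioi (0 : ℝ), w u * Real.exp (-(b u * r ^ 2)) := by
  rw [integral_eq_lintegral_of_nonneg_ae _ (Measurable.aestronglyMeasurable (by fun_prop))]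
  filter_upwards [self_mem_ae_restrict measurableSet_Ioi] with u hu
  exact mul_nonneg (hw0 u hu) (Real.exp_nonneg _)

theorem continuous_lintegral_ofReal_mul_exp {w b : ℝ → ℝ} (hw : Measurable w) (hb : Measurable b)
    (hw0 : ∀ u, 0 < u → 0 ≤ w u) (hb0 : ∀ u, 0 < u → 0 < b u)
    (hint : ∀ r : ℝ, 0 < r → IntegrableOn (fun u => w u * Real.exp (-(b u * r ^ 2))) (Set.Ioi 0)) :
    Continuous fun r : ℝ≥0 =>
      ∫⁻ u in Set.Ioi (0 : ℝ), ENNReal.ofReal (w u * Real.exp (-(b u * (r : ℝ) ^ 2))) := by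
  have hmono : ∀ r s : ℝ≥0, r ≤ s → ∀ᵐ u ∂(volume.restrict (Set.Ioi (0 : ℝ))),
      ENNReal.ofReal (w u * Real.exp (-(b u * (s : ℝ) ^ 2))) ≤
        ENNReal.ofReal (w u * Real.exp (-(b u * (r : ℝ) ^ 2))) := by
    intro r s hrs
    filter_upwards [self_mem_ae_restrict measurableSet_Ioi] with u hu
    have h1 := hw0 u hu
    have h2 := (hb0 u hu).le
    have h3 : (r : ℝ) ≤ s := hrs
    gcongr
  have hlim : ∀ (r : ℝ≥0) (u : ℝ), Tendsto (fun s : ℝ≥0 =>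
      ENNReal.ofReal (w u * Real.exp (-(b u * (s : ℝ) ^ 2)))) (𝓝 r)
      (𝓝 (ENNReal.ofReal (w u * Real.exp (-(b u * (r : ℝ) ^ 2))))) := fun r u =>
    Continuous.tendsto (f := fun s : ℝ≥0 =>
      ENNReal.ofReal (w u * Real.exp (-(b u * (s : ℝ) ^ 2))))
      (ENNReal.continuous_ofReal.comp (by fun_prop)) r
  rw [continuous_iff_continuousAt]
  intro r
  -- The value at 0 may be `∞`, so domination is unavailable there: Fatou gives the lower bound and
  -- monotonicity in the radius the upper one.
  rcases eq_zero_or_pos r with rfl | hr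
  · refine tendsto_of_le_liminf_of_limsup_le ?_ ?_
    · refine le_trans (le_of_eq ?_) (lintegral_liminf_le fun s => by fun_prop)
      exact lintegral_congr fun u => ((hlim 0 u).liminf_eq).symm
    · refine limsup_le_of_le (by isBoundedDefault) (Eventually.of_forall fun s => ?_)
      exact lintegral_mono_ae (hmono 0 s zero_le)
  · have hr2 : 0 < r / 2 := half_pos hr
    refine tendsto_lintegral_filter_of_dominated_convergence
      (fun u => ENNReal.ofReal (w u * Real.exp (-(b u * ((r / 2 : ℝ≥0) : ℝ) ^ 2))))
      (Eventually.of_forall fun s => by fun_prop) ?_ ?_ (ae_of_all _ (hlim r))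
    · filter_upwards [lt_mem_nhds (half_lt_self hr)] with s hs using hmono _ _ hs.le
    · exact (Integrable.lintegral_lt_top (hint _ (by exact_mod_cast hr2))).ne

/-! ### Integrability and Laplace asymptotics of the weights -/

theorem integrableOn_rpow_mul_add_rpow {a b c : ℝ} (ha : 0 < a) (hb : 0 < b) (hc : 0 < c) :
    IntegrableOn (fun x : ℝ => x ^ (a - 1) * (x + b) ^ (-(a + c))) (Set.Ioi 0) := by
  rw [← Set.Ioc_union_Ioi_eq_Ioi zero_le_one]
  have hmeas : Measurable fun x : ℝ => x ^ (a - 1) * (x + b) ^ (-(a + c)) := by fun_prop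
  refine IntegrableOn.union ?_ ?_
  · have h : IntegrableOn (fun x : ℝ => x ^ (a - 1) * b ^ (-(a + c))) (Set.Ioc 0 1) := by
      rw [← intervalIntegrable_iff_integrableOn_Ioc_of_le zero_le_one]
      exact (intervalIntegral.intervalIntegrable_rpow' (by linarith)).mul_const _
    refine Integrable.mono' h hmeas.aestronglyMeasurable ?_
    filter_upwards [self_mem_ae_restrict measurableSet_Ioc] with x hx
    have hx0 : 0 < x := hx.1
    rw [Real.norm_of_nonneg (by positivity)]
    exact mul_le_mul_of_nonneg_left
      (Real.rpow_le_rpow_of_nonpos hb (by linarith) (by linarith)) (by positivity)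
  · refine Integrable.mono' (integrableOn_Ioi_rpow_of_lt (a := -c - 1) (by linarith) one_pos)
      hmeas.aestronglyMeasurable ?_
    filter_upwards [self_mem_ae_restrict measurableSet_Ioi] with x hx
    have hx0 : 0 < x := one_pos.trans hx
    rw [Real.norm_of_nonneg (by positivity)]
    calc x ^ (a - 1) * (x + b) ^ (-(a + c)) ≤ x ^ (a - 1) * x ^ (-(a + c)) :=
          mul_le_mul_of_nonneg_left
            (Real.rpow_le_rpow_of_nonpos hx0 (by linarith) (by linarith)) (by positivity)
      _ = x ^ (-c - 1) := by rw [← Real.rpow_add hx0]; congr 1; ring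

theorem integrableOn_rpow_mul_add_rpow_mul_exp {a b s c : ℝ} (ha : 0 < a) (hb : 0 < b)
    (hs : 0 ≤ s) (hc : 0 < c) :
    IntegrableOn (fun x : ℝ => x ^ (a - 1) * (x + b) ^ (-s) * Real.exp (-(c * x))) (Set.Ioi 0) := by
  have h := (integrableOn_rpow_mul_exp_neg_mul_rpow (p := 1) (s := a - 1) (by linarith) one_pos
    hc).const_mul (b ^ (-s))
  refine Integrable.mono' h (Measurable.aestronglyMeasurable (by fun_prop)) ?_
  filter_upwards [self_mem_ae_restrict measurableSet_Ioi] with x hx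
  have hx0 : 0 < x := hx
  rw [Real.norm_of_nonneg (by positivity), Real.rpow_one, neg_mul,
    mul_comm (x ^ (a - 1)), mul_assoc]
  exact mul_le_mul_of_nonneg_right
    (Real.rpow_le_rpow_of_nonpos hb (by linarith) (by linarith)) (by positivity)

/-- Substituting `v = l x` turns the second factor into `(v / l + b)^(-s)`, which tends to `b^(-s)`
and is bounded by it; what remains is the Gamma integral. -/
theorem tendsto_rpow_mul_laplace_rpow_mul_add_rpow {a b s : ℝ} (ha : 0 < a) (hb : 0 < b)
    (hs : 0 ≤ s) :
    Tendsto (fun l : ℝ => l ^ a *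
        ∫ x in Set.Ioi (0 : ℝ), x ^ (a - 1) * (x + b) ^ (-s) * Real.exp (-(l * x))) atTop
      (𝓝 (b ^ (-s) * Real.Gamma a)) := by
  have hscale : ∀ l : ℝ, 0 < l → l ^ a *
      ∫ x in Set.Ioi (0 : ℝ), x ^ (a - 1) * (x + b) ^ (-s) * Real.exp (-(l * x)) =
      ∫ v in Set.Ioi (0 : ℝ), (v / l + b) ^ (-s) * (Real.exp (-v) * v ^ (a - 1)) := by
    intro l hl
    have h := integral_comp_mul_left_Ioi
      (fun v => (v / l + b) ^ (-s) * (Real.exp (-v) * v ^ (a - 1))) 0 hl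
    rw [mul_zero, smul_eq_mul, eq_inv_mul_iff_mul_eq₀ hl.ne'] at h
    rw [← h, ← integral_const_mul, ← integral_const_mul]
    refine setIntegral_congr_fun measurableSet_Ioi fun x hx => ?_
    have hx0 : 0 < x := hx
    have hla : l ^ a = l * l ^ (a - 1) := by
      rw [Real.rpow_sub_one hl.ne', mul_div_cancel₀ _ hl.ne']
    rw [mul_div_cancel_left₀ _ hl.ne', Real.mul_rpow hl.le hx0.le, hla]
    ring
  have hG : ∫ v in Set.Ioi (0 : ℝ), b ^ (-s) * (Real.exp (-v) * v ^ (a - 1)) =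
      b ^ (-s) * Real.Gamma a := by
    rw [integral_const_mul, Real.Gamma_eq_integral ha]
  rw [← hG]
  refine Tendsto.congr' (f₁ := fun l : ℝ =>
    ∫ v in Set.Ioi (0 : ℝ), (v / l + b) ^ (-s) * (Real.exp (-v) * v ^ (a - 1)))
    ((eventually_gt_atTop 0).mono fun l hl => (hscale l hl).symm) ?_
  refine tendsto_integral_filter_of_dominated_convergence
    (fun v => b ^ (-s) * (Real.exp (-v) * v ^ (a - 1)))
    (Eventually.of_forall fun l => Measurable.aestronglyMeasurable (by fun_prop)) ?_
    ((Real.GammaIntegral_convergent ha).const_mul _) (ae_of_all _ fun v => ?_)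
  · filter_upwards [eventually_gt_atTop 0] with l hl
    filter_upwards [self_mem_ae_restrict measurableSet_Ioi] with v hv
    have hv0 : 0 < v := hv
    rw [Real.norm_of_nonneg (by positivity)]
    exact mul_le_mul_of_nonneg_right (Real.rpow_le_rpow_of_nonpos hb
      (le_add_of_nonneg_left (by positivity)) (by linarith)) (by positivity)
  · have h : Tendsto (fun l : ℝ => v / l + b) atTop (𝓝 b) := by
      simpa using (tendsto_const_nhds.div_atTop tendsto_id).add_const b
    exact (h.rpow_const (Or.inl hb.ne')).mul_const _

/-! ### Uniqueness of the spectral density -/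

theorem charFun_withDensity_of_isSpectralDensity {d : ℕ} {C : ℝ → ℝ} {f : ℝ≥0 → ℝ≥0∞}
    (hf : IsSpectralDensity d C f) (x : EuclideanSpace ℝ (Fin d)) :
    charFun ((volume : Measure (EuclideanSpace ℝ (Fin d))).withDensity fun ω => f ‖ω‖₊) x =
      C ‖x‖ := by
  obtain ⟨hc, hfin, hC⟩ := hf
  have hm : Measurable fun ω : EuclideanSpace ℝ (Fin d) => f ‖ω‖₊ :=
    (hc.comp continuous_nnnorm).measurable
  rw [charFun_apply, integral_withDensity_eq_integral_toReal_smul hm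
    (ae_lt_top hm hfin.ne), hC x]
  congr with ω
  rw [Complex.real_smul, real_inner_comm, mul_comm, mul_comm Complex.I]

theorem IsSpectralDensity.unique {d : ℕ} (hd : 1 ≤ d) {C : ℝ → ℝ} {f g : ℝ≥0 → ℝ≥0∞}
    (hf : IsSpectralDensity d C f) (hg : IsSpectralDensity d C g) : f = g := by
  have hcf : Continuous fun ω : EuclideanSpace ℝ (Fin d) => f ‖ω‖₊ := hf.1.comp continuous_nnnorm
  have hcg : Continuous fun ω : EuclideanSpace ℝ (Fin d) => g ‖ω‖₊ := hg.1.comp continuous_nnnorm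
  have := isFiniteMeasure_withDensity hf.2.1.ne
  have := isFiniteMeasure_withDensity hg.2.1.ne
  have hμ : (volume : Measure (EuclideanSpace ℝ (Fin d))).withDensity (fun ω => f ‖ω‖₊) =
      volume.withDensity (fun ω => g ‖ω‖₊) := by
    refine Measure.ext_of_charFun (funext fun x => ?_)
    rw [charFun_withDensity_of_isSpectralDensity hf, charFun_withDensity_of_isSpectralDensity hg]
  rw [withDensity_eq_iff hcf.measurable.aemeasurable hcg.measurable.aemeasurable hf.2.1.ne,
    Continuous.ae_eq_iff_eq volume hcf hcg] at hμ
  funext r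
  -- `1 ≤ d` supplies a vector of each norm `r`.
  have h := congrFun hμ (EuclideanSpace.single ⟨0, hd⟩ (r : ℝ))
  have hr : ‖EuclideanSpace.single (⟨0, hd⟩ : Fin d) (r : ℝ)‖₊ = r := by
    ext
    simp
  simpa only [hr] using h

/-! ### Slow variation -/

theorem tendsto_tailL {d : ℕ} {ν β : ℝ} : Tendsto (tailL d ν β) atTop (𝓝 1) := by
  have h : Tendsto (fun x : ℝ => x / (x + β ^ 2 / (2 * ν))) atTop (𝓝 1) := by
    have h1 : Tendsto (fun x : ℝ => 1 - β ^ 2 / (2 * ν) / (x + β ^ 2 / (2 * ν))) atTop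
        (𝓝 (1 - 0)) :=
      tendsto_const_nhds.sub
        (tendsto_const_nhds.div_atTop (tendsto_atTop_add_const_right _ _ tendsto_id))
    rw [sub_zero] at h1
    refine h1.congr' ?_
    filter_upwards [eventually_gt_atTop (-(β ^ 2 / (2 * ν)))] with x hx
    have hx' : x + β ^ 2 / (2 * ν) ≠ 0 := by linarith
    rw [eq_div_iff hx', sub_mul, div_mul_cancel₀ _ hx']
    ring
  have h2 := h.rpow_const (p := ν + (d : ℝ) / 2) (Or.inl one_ne_zero)
  rwa [Real.one_rpow] at h2

theorem slowlyVarying_of_tendsto {L : ℝ → ℝ} {c : ℝ} (hc : c ≠ 0) (hL : Tendsto L atTop (𝓝 c)) :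
    SlowlyVarying L := by
  intro t ht
  have h := (hL.comp (tendsto_id.const_mul_atTop ht)).div hL hc
  rwa [div_self hc] at h

/-- The weight of the Gaussian scale mixture that defines the covariance `chCov`. -/
noncomputable def chWeight (ν α β σ u : ℝ) : ℝ :=
  σ ^ 2 * β ^ (2 * α) * Real.Gamma (ν + α) / (Real.Gamma ν * Real.Gamma α) *
    (u ^ (ν - 1) * (u + β ^ 2) ^ (-(ν + α)))

/-- The weight of the Gaussian scale mixture that defines the spectral density of `chCov`. -/
noncomputable def chSpectralWeight (d : ℕ) (ν α β σ u : ℝ) : ℝ :=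
  chWeight ν α β σ u * (u / (4 * Real.pi * ν)) ^ ((d : ℝ) / 2)

/-- The spectral density of `chCov`. -/
noncomputable def chSpectralDensity (d : ℕ) (ν α β σ : ℝ) (r : ℝ≥0) : ℝ≥0∞ :=
  ∫⁻ u in Set.Ioi (0 : ℝ), ENNReal.ofReal
    (chSpectralWeight d ν α β σ u * Real.exp (-(u / (4 * ν) * (r : ℝ) ^ 2)))

@[fun_prop]
theorem measurable_chWeight (ν α β σ : ℝ) : Measurable (chWeight ν α β σ) := by
  unfold chWeight
  fun_prop

@[fun_prop]
theorem measurable_chSpectralWeight (d : ℕ) (ν α β σ : ℝ) :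
    Measurable (chSpectralWeight d ν α β σ) := by
  unfold chSpectralWeight
  fun_prop

theorem chCov_eq_integral_chWeight (ν α β σ h : ℝ) :
    chCov ν α β σ h =
      ∫ u in Set.Ioi (0 : ℝ), chWeight ν α β σ u * Real.exp (-(ν / u * h ^ 2)) := by
  rw [chCov, ← integral_const_mul]
  congr with u
  rw [chWeight, div_mul_eq_mul_div ν]
  ring

/-! ### The CH spectral density: existence, inversion, tail -/

section Density

variable {d : ℕ} {ν α β σ : ℝ}

theorem chWeight_nonneg (hν : 0 < ν) (hα : 0 < α) (hβ : 0 < β) {u : ℝ} (hu : 0 < u) :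
    0 ≤ chWeight ν α β σ u := by
  have := Real.Gamma_pos_of_pos hν
  have := Real.Gamma_pos_of_pos hα
  have := Real.Gamma_pos_of_pos (add_pos hν hα)
  unfold chWeight
  positivity

theorem chSpectralWeight_nonneg (hν : 0 < ν) (hα : 0 < α) (hβ : 0 < β) {u : ℝ} (hu : 0 < u) :
    0 ≤ chSpectralWeight d ν α β σ u :=
  mul_nonneg (chWeight_nonneg hν hα hβ hu) (by positivity)

theorem chSpectralWeight_eq (hν : 0 < ν) {u : ℝ} (hu : 0 < u) :
    chSpectralWeight d ν α β σ u =
      σ ^ 2 * β ^ (2 * α) * Real.Gamma (ν + α) / (Real.Gamma ν * Real.Gamma α) *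
        (4 * Real.pi * ν) ^ (-((d : ℝ) / 2)) *
        (u ^ (ν + (d : ℝ) / 2 - 1) * (u + β ^ 2) ^ (-(ν + α))) := by
  have hp : 0 < 4 * Real.pi * ν := by positivity
  rw [chSpectralWeight, chWeight, Real.div_rpow hu.le hp.le, Real.rpow_neg hp.le,
    show ν + (d : ℝ) / 2 - 1 = (ν - 1) + (d : ℝ) / 2 by ring, Real.rpow_add hu]
  ring

theorem integrableOn_chWeight (hν : 0 < ν) (hα : 0 < α) (hβ : 0 < β) :
    IntegrableOn (chWeight ν α β σ) (Set.Ioi 0) :=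
  (integrableOn_rpow_mul_add_rpow hν (pow_pos hβ 2) hα).const_mul _

theorem integrableOn_chSpectralWeight (hν : 0 < ν) (hβ : 0 < β) (hα : (d : ℝ) / 2 < α) :
    IntegrableOn (chSpectralWeight d ν α β σ) (Set.Ioi 0) := by
  have hd : (0 : ℝ) ≤ (d : ℝ) / 2 := by positivity
  -- At infinity the weight decays like `u^(-(α - d/2) - 1)`, hence the exponents `a = ν + d/2` and
  -- `c = α - d/2`.
  have h := (integrableOn_rpow_mul_add_rpow (add_pos_of_pos_of_nonneg hν hd) (pow_pos hβ 2)
    (sub_pos.2 hα)).const_mul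
    (σ ^ 2 * β ^ (2 * α) * Real.Gamma (ν + α) / (Real.Gamma ν * Real.Gamma α) *
        (4 * Real.pi * ν) ^ (-((d : ℝ) / 2)))
  refine IntegrableOn.congr_fun h (fun u hu => ?_) measurableSet_Ioi
  rw [chSpectralWeight_eq hν hu]
  ring_nf

theorem integrableOn_chSpectralWeight_mul_exp (hν : 0 < ν) (hα : 0 < α) (hβ : 0 < β) {r : ℝ}
    (hr : 0 < r) :
    IntegrableOn (fun u => chSpectralWeight d ν α β σ u * Real.exp (-(u / (4 * ν) * r ^ 2)))
      (Set.Ioi 0) := by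
  have hd : (0 : ℝ) ≤ (d : ℝ) / 2 := by positivity
  have h := (integrableOn_rpow_mul_add_rpow_mul_exp (add_pos_of_pos_of_nonneg hν hd) (pow_pos hβ 2)
    (add_pos hν hα).le (c := r ^ 2 / (4 * ν)) (by positivity)).const_mul
    (σ ^ 2 * β ^ (2 * α) * Real.Gamma (ν + α) / (Real.Gamma ν * Real.Gamma α) *
        (4 * Real.pi * ν) ^ (-((d : ℝ) / 2)))
  refine IntegrableOn.congr_fun h (fun u hu => ?_) measurableSet_Ioi
  rw [chSpectralWeight_eq hν hu]
  ring_nf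

theorem toReal_chSpectralDensity (hν : 0 < ν) (hα : 0 < α) (hβ : 0 < β) (r : ℝ≥0) :
    (chSpectralDensity d ν α β σ r).toReal = ∫ u in Set.Ioi (0 : ℝ),
      chSpectralWeight d ν α β σ u * Real.exp (-(u / (4 * ν) * (r : ℝ) ^ 2)) :=
  toReal_lintegral_ofReal_mul_exp (b := fun u => u / (4 * ν)) (by fun_prop) (by fun_prop)
    (fun _ hu => chSpectralWeight_nonneg hν hα hβ hu) r

theorem continuous_chSpectralDensity (hν : 0 < ν) (hα : 0 < α) (hβ : 0 < β) :
    Continuous (chSpectralDensity d ν α β σ) :=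
  continuous_lintegral_ofReal_mul_exp (b := fun u => u / (4 * ν)) (by fun_prop) (by fun_prop)
    (fun _ hu => chSpectralWeight_nonneg hν hα hβ hu) (fun _ hu => by positivity)
    fun _ hr => integrableOn_chSpectralWeight_mul_exp hν hα hβ hr

theorem chSpectralDensity_lt_top (hν : 0 < ν) (hβ : 0 < β) (hα : (d : ℝ) / 2 < α) (r : ℝ≥0) :
    chSpectralDensity d ν α β σ r < ∞ := by
  have hα0 : 0 < α := lt_of_le_of_lt (by positivity) hα
  refine lt_of_le_of_lt (setLIntegral_mono' measurableSet_Ioi fun u hu => ?_)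
    (integrableOn_chSpectralWeight (σ := σ) hν hβ hα).lintegral_lt_top
  have hu0 : 0 < u := hu
  refine ENNReal.ofReal_le_ofReal (mul_le_of_le_one_right
    (chSpectralWeight_nonneg hν hα0 hβ hu) (Real.exp_le_one_iff.2 ?_))
  exact neg_nonpos.2 (by positivity)

theorem chSpectralWeight_mul_rpow (hν : 0 < ν) {u : ℝ} (hu : 0 < u) :
    chSpectralWeight d ν α β σ u * (Real.pi / (u / (4 * ν))) ^ ((d : ℝ) / 2) =
      chWeight ν α β σ u := by
  have hp := Real.pi_pos
  rw [chSpectralWeight, mul_assoc, ← Real.mul_rpow (by positivity) (by positivity)]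
  have h : u / (4 * Real.pi * ν) * (Real.pi / (u / (4 * ν))) = 1 := by
    field_simp
  rw [h, Real.one_rpow, mul_one]

theorem isSpectralDensity_chSpectralDensity (hν : 0 < ν) (hα : 0 < α) (hβ : 0 < β) :
    IsSpectralDensity d (chCov ν α β σ) (chSpectralDensity d ν α β σ) := by
  have hint : IntegrableOn (fun u => chSpectralWeight d ν α β σ u *
      (Real.pi / (u / (4 * ν))) ^ ((Module.finrank ℝ (EuclideanSpace ℝ (Fin d)) : ℝ) / 2))
      (Set.Ioi 0) := by
    rw [finrank_euclideanSpace_fin]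
    exact IntegrableOn.congr_fun (integrableOn_chWeight hν hα hβ)
      (fun u hu => (chSpectralWeight_mul_rpow hν hu).symm) measurableSet_Ioi
  refine ⟨continuous_chSpectralDensity hν hα hβ, ?_, fun x => ?_⟩
  · exact lintegral_gaussianMixture_lt_top (b := fun u => u / (4 * ν)) (by fun_prop) (by fun_prop)
      (fun _ hu => chSpectralWeight_nonneg hν hα hβ hu) (fun _ hu => by positivity) hint
  · have h := integral_cexp_mul_gaussianMixture (b := fun u => u / (4 * ν)) (by fun_prop)
      (by fun_prop) (fun _ hu => chSpectralWeight_nonneg hν hα hβ hu) (fun _ hu => by positivity)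
      hint x
    simp_rw [toReal_chSpectralDensity hν hα hβ, coe_nnnorm]
    rw [h, chCov_eq_integral_chWeight, finrank_euclideanSpace_fin]
    congr 1
    refine setIntegral_congr_fun measurableSet_Ioi fun u hu => ?_
    have hu0 : 0 < u := hu
    rw [chSpectralWeight_mul_rpow hν hu]
    congr 4
    field_simp

theorem chWeight_mul_rpow (hν : 0 < ν) {u : ℝ} (hu : 0 < u) :
    chWeight ν α β σ u * (Real.pi / (ν / u)) ^ ((d : ℝ) / 2) =
      (2 * Real.pi) ^ d * chSpectralWeight d ν α β σ u := by
  have hp := Real.pi_pos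
  have h : Real.pi / (ν / u) = (2 * Real.pi) ^ 2 * (u / (4 * Real.pi * ν)) := by
    field_simp
    norm_num
  have h2 : ((2 * Real.pi) ^ 2) ^ ((d : ℝ) / 2) = (2 * Real.pi) ^ d := by
    rw [← Real.rpow_natCast_mul (by positivity), ← Real.rpow_natCast]
    congr 1
    push_cast
    ring
  rw [h, Real.mul_rpow (by positivity) (by positivity), h2, chSpectralWeight]
  ring

theorem integrableOn_chWeight_mul_rpow (hν : 0 < ν) (hβ : 0 < β) (hα : (d : ℝ) / 2 < α) :
    IntegrableOn (fun u => chWeight ν α β σ u *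
      (Real.pi / (ν / u)) ^ ((Module.finrank ℝ (EuclideanSpace ℝ (Fin d)) : ℝ) / 2))
      (Set.Ioi 0) := by
  rw [finrank_euclideanSpace_fin]
  exact IntegrableOn.congr_fun ((integrableOn_chSpectralWeight hν hβ hα).const_mul _)
    (fun u hu => (chWeight_mul_rpow hν hu).symm) measurableSet_Ioi

theorem integrable_chCov_norm (hν : 0 < ν) (hβ : 0 < β) (hα : (d : ℝ) / 2 < α) :
    Integrable fun x : EuclideanSpace ℝ (Fin d) => chCov ν α β σ ‖x‖ := by
  have hα0 : 0 < α := lt_of_le_of_lt (by positivity) hα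
  simp_rw [chCov_eq_integral_chWeight]
  exact integrable_gaussianMixture (b := fun u => ν / u) (by fun_prop) (by fun_prop)
    (fun _ hu => chWeight_nonneg hν hα0 hβ hu) (fun _ hu => by positivity)
    (integrableOn_chWeight_mul_rpow hν hβ hα)

theorem toReal_chSpectralDensity_eq_integral_chCov (hν : 0 < ν) (hβ : 0 < β)
    (hα : (d : ℝ) / 2 < α) (ω : EuclideanSpace ℝ (Fin d)) :
    ((chSpectralDensity d ν α β σ ‖ω‖₊).toReal : ℂ) = (1 / (2 * (Real.pi : ℂ)) ^ d) *
      ∫ x : EuclideanSpace ℝ (Fin d),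
        Complex.exp (-(Complex.I * (inner ℝ ω x : ℝ))) * (chCov ν α β σ ‖x‖ : ℂ) := by
  have hα0 : 0 < α := lt_of_le_of_lt (by positivity) hα
  -- Evaluating at `-ω` produces the sign of the inverse transform.
  have h := integral_cexp_mul_gaussianMixture (b := fun u => ν / u) (by fun_prop) (by fun_prop)
    (fun _ hu => chWeight_nonneg (σ := σ) hν hα0 hβ hu) (fun _ hu => by positivity)
    (integrableOn_chWeight_mul_rpow hν hβ hα) (-ω)
  simp only [← chCov_eq_integral_chWeight, inner_neg_left, norm_neg, Complex.ofReal_neg,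
    mul_neg] at h
  have h2 : ∫ u in Set.Ioi (0 : ℝ), chWeight ν α β σ u *
      (Real.pi / (ν / u)) ^ ((Module.finrank ℝ (EuclideanSpace ℝ (Fin d)) : ℝ) / 2) *
      Real.exp (-(1 / (4 * (ν / u)) * ‖ω‖ ^ 2)) =
      (2 * Real.pi) ^ d * (chSpectralDensity d ν α β σ ‖ω‖₊).toReal := by
    rw [toReal_chSpectralDensity hν hα0 hβ, finrank_euclideanSpace_fin, ← integral_const_mul]
    refine setIntegral_congr_fun measurableSet_Ioi fun u hu => ?_
    have hu0 : 0 < u := hu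
    rw [chWeight_mul_rpow hν hu, mul_assoc, coe_nnnorm]
    congr 5
    field_simp
  have hp : (2 * (Real.pi : ℂ)) ^ d ≠ 0 :=
    pow_ne_zero _ (mul_ne_zero two_ne_zero (Complex.ofReal_ne_zero.2 Real.pi_ne_zero))
  rw [h, h2]
  push_cast
  field_simp

theorem tendsto_rpow_mul_chSpectralDensity (hν : 0 < ν) (hα : 0 < α) (hβ : 0 < β) :
    Tendsto (fun ω : ℝ => (ω ^ 2 / (4 * ν)) ^ (ν + (d : ℝ) / 2) *
        (chSpectralDensity d ν α β σ ω.toNNReal).toReal) atTop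
      (𝓝 (σ ^ 2 * β ^ (2 * α) * Real.Gamma (ν + α) / (Real.Gamma ν * Real.Gamma α) *
        (4 * Real.pi * ν) ^ (-((d : ℝ) / 2)) *
        ((β ^ 2) ^ (-(ν + α)) * Real.Gamma (ν + (d : ℝ) / 2)))) := by
  have hd : (0 : ℝ) ≤ (d : ℝ) / 2 := by positivity
  have hl : Tendsto (fun ω : ℝ => ω ^ 2 / (4 * ν)) atTop atTop :=
    (tendsto_pow_atTop two_ne_zero).atTop_div_const (by positivity)
  have h := ((tendsto_rpow_mul_laplace_rpow_mul_add_rpow (add_pos_of_pos_of_nonneg hν hd)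
    (pow_pos hβ 2) (add_pos hν hα).le).comp hl).const_mul
    (σ ^ 2 * β ^ (2 * α) * Real.Gamma (ν + α) / (Real.Gamma ν * Real.Gamma α) *
        (4 * Real.pi * ν) ^ (-((d : ℝ) / 2)))
  refine h.congr' ?_
  filter_upwards [eventually_ge_atTop 0] with ω hω
  rw [toReal_chSpectralDensity hν hα hβ, Real.coe_toNNReal _ hω, Function.comp_apply,
    mul_left_comm, ← integral_const_mul]
  congr 1
  refine setIntegral_congr_fun measurableSet_Ioi fun u hu => ?_
  rw [chSpectralWeight_eq hν hu]
  ring_nf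

theorem isEquivalent_chSpectralDensity (hν : 0 < ν) (hα : 0 < α) (hβ : 0 < β) (hσ : 0 < σ) :
    (fun ω : ℝ => (chSpectralDensity d ν α β σ ω.toNNReal).toReal) ~[atTop]
      (fun ω : ℝ =>
        σ ^ 2 * 2 ^ (2 * ν) * ν ^ ν * Real.Gamma (ν + α) /
            (Real.pi ^ ((d : ℝ) / 2) * β ^ (2 * ν) * Real.Gamma α) *
          (Real.Gamma (ν + (d : ℝ) / 2) / Real.Gamma ν) *
          ω ^ (-(2 * ν + (d : ℝ))) * tailL d ν β (ω ^ 2)) := by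
  have h1 := tendsto_rpow_mul_chSpectralDensity (d := d) (σ := σ) hν hα hβ
  set c := σ ^ 2 * β ^ (2 * α) * Real.Gamma (ν + α) / (Real.Gamma ν * Real.Gamma α) *
        (4 * Real.pi * ν) ^ (-((d : ℝ) / 2)) *
        ((β ^ 2) ^ (-(ν + α)) * Real.Gamma (ν + (d : ℝ) / 2)) with hc
  have hΓν := Real.Gamma_pos_of_pos hν
  have hΓα := Real.Gamma_pos_of_pos hα
  have hΓνα := Real.Gamma_pos_of_pos (add_pos hν hα)
  have hΓνd : 0 < Real.Gamma (ν + (d : ℝ) / 2) := Real.Gamma_pos_of_pos (by positivity)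
  have hp := Real.pi_pos
  have hc0 : c ≠ 0 := by positivity
  have h2 : Tendsto (fun ω : ℝ => c * tailL d ν β (ω ^ 2)) atTop (𝓝 c) := by
    simpa using (tendsto_tailL.comp (tendsto_pow_atTop two_ne_zero)).const_mul c
  have h3 := h1.div h2 hc0
  rw [div_self hc0] at h3
  refine isEquivalent_of_tendsto_one (h3.congr' ?_)
  filter_upwards [eventually_gt_atTop 0] with ω hω
  have hl : 0 < (ω ^ 2 / (4 * ν)) ^ (ν + (d : ℝ) / 2) := by positivity
  -- `c` is the limit constant in the variable `ω² / (4ν)`; rewriting it in powers of `ω` gives the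
  -- stated constant.
  have hcω : c = (ω ^ 2 / (4 * ν)) ^ (ν + (d : ℝ) / 2) *
      (σ ^ 2 * 2 ^ (2 * ν) * ν ^ ν * Real.Gamma (ν + α) /
            (Real.pi ^ ((d : ℝ) / 2) * β ^ (2 * ν) * Real.Gamma α) *
          (Real.Gamma (ν + (d : ℝ) / 2) / Real.Gamma ν) * ω ^ (-(2 * ν + (d : ℝ)))) := by
    have e1 : (ω ^ 2) ^ (ν + (d : ℝ) / 2) = ω ^ (2 * ν + (d : ℝ)) := by
      rw [← Real.rpow_natCast_mul hω.le]
      congr 1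
      push_cast
      ring
    have e2 : (β ^ 2) ^ (ν + α) = β ^ (2 * ν) * β ^ (2 * α) := by
      rw [← Real.rpow_natCast_mul hβ.le, ← Real.rpow_add hβ]
      congr 1
      push_cast
      ring
    have e3 : (4 * ν) ^ (ν + (d : ℝ) / 2) =
        2 ^ (2 * ν) * ν ^ ν * (4 * ν) ^ ((d : ℝ) / 2) := by
      rw [Real.rpow_add (by positivity), Real.mul_rpow (by norm_num) hν.le,
        show (4 : ℝ) = 2 ^ (2 : ℝ) by norm_num, ← Real.rpow_mul (by norm_num)]
    have e4 : (4 * Real.pi * ν) ^ ((d : ℝ) / 2) =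
        (4 * ν) ^ ((d : ℝ) / 2) * Real.pi ^ ((d : ℝ) / 2) := by
      rw [← Real.mul_rpow (by positivity) hp.le]
      congr 1
      ring
    rw [hc, Real.div_rpow (by positivity) (by positivity), e1, e3, Real.rpow_neg (by positivity),
      Real.rpow_neg (by positivity), Real.rpow_neg hω.le, e2, e4]
    field_simp
  simp only [Pi.div_apply]
  rw [hcω, mul_assoc ((ω ^ 2 / (4 * ν)) ^ (ν + (d : ℝ) / 2)), mul_div_mul_left _ _ hl.ne']

end Density

theorem proposition1 (d : ℕ) (hd : 1 ≤ d) (ν α β σ : ℝ)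
    (hν : 0 < ν) (hα : 0 < α) (hβ : 0 < β) (hσ : 0 < σ) :
    (∃! f : ℝ≥0 → ℝ≥0∞, IsSpectralDensity d (chCov ν α β σ) f) ∧
    SlowlyVarying (tailL d ν β) ∧
    ∀ f : ℝ≥0 → ℝ≥0∞, IsSpectralDensity d (chCov ν α β σ) f →
      (fun ω : ℝ => (f ω.toNNReal).toReal) ~[atTop]
        (fun ω : ℝ =>
          σ ^ 2 * 2 ^ (2 * ν) * ν ^ ν * Real.Gamma (ν + α) /
              (Real.pi ^ ((d : ℝ) / 2) * β ^ (2 * ν) * Real.Gamma α) *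
            (Real.Gamma (ν + (d : ℝ) / 2) / Real.Gamma ν) *
            ω ^ (-(2 * ν + (d : ℝ))) * tailL d ν β (ω ^ 2)) ∧
      ((d : ℝ) / 2 < α →
        (∀ ω : ℝ≥0, f ω < ∞) ∧
        Integrable (fun x : EuclideanSpace ℝ (Fin d) => chCov ν α β σ ‖x‖) ∧
        ∀ ω : EuclideanSpace ℝ (Fin d),
          ((f ‖ω‖₊).toReal : ℂ) = (1 / (2 * (Real.pi : ℂ)) ^ d) *
            ∫ x : EuclideanSpace ℝ (Fin d),
              Complex.exp (-(Complex.I * (inner ℝ ω x : ℝ))) * (chCov ν α β σ ‖x‖ : ℂ)) := by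
  have hspec : IsSpectralDensity d (chCov ν α β σ) (chSpectralDensity d ν α β σ) :=
    isSpectralDensity_chSpectralDensity hν hα hβ
  refine ⟨⟨_, hspec, fun f hf => hf.unique hd hspec⟩,
    slowlyVarying_of_tendsto one_ne_zero tendsto_tailL, fun f hf => ?_⟩
  obtain rfl := hf.unique hd hspec
  exact ⟨isEquivalent_chSpectralDensity hν hα hβ hσ, fun hdα =>
    ⟨chSpectralDensity_lt_top hν hβ hdα, integrable_chCov_norm hν hβ hdα,
      toReal_chSpectralDensity_eq_integral_chCov hν hβ hdα⟩⟩
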